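/- Let $d\ge n\ge 1$ be integers. Let $H_0\in\mathbb{R}^{d\times n}$ be a (possibly random) input matrix with $\|H_0\|_F=1$ almost surely, and let $W_0,W_1,\dots\in\mathbb{R}^{d\times d}$ be random matrices all of whose entries are i.i.d. $\mathcal N(0,1/d)$, independent of $H_0$. Define the hidden representations of the batch-normalized linear network by $$H_{k+1}=\frac1{\sqrt d}\,BN(W_kH_k),\qquad BN(M)=\operatorname{diag}(MM^\top)^{-1/2}M,\qquad k\ge 0,$$ where $\operatorname{diag}(A)$ denotes $A$ with its off-diagonal entries replaced by zero (almost surely no row of $W_kH_k$ vanishes; by convention $BN$ leaves a zero row equal to zero). For $H\in\mathbb{R}^{d\times n}$ let $\sigma_n(H)$ be its smallest ($n$-th largest) singular value and put $\widehat V(H)=\frac1n-\sigma_n(H)^2$. Then, with no lower bound on the singular values of the $H_k$ being assumed, for every $\ell\ge 1$ the expectations below exist and $$\mathbb{E}\left[\frac1\ell\sum_{k=1}^{\ell}\widehat V(H_k)\left(\frac1n-\widehat V(H_k)\right)\right]\le\frac{3\,\mathbb{E}[\widehat V(H_0)]}{2\ell}+\frac{3}{2\sqrt d}.$$ -/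

import Mathlib

open MeasureTheory ProbabilityTheory

noncomputable section

namespace BNChain

section Norm

open scoped Matrix.Norms.Frobenius

/-- The Frobenius norm of a real matrix. -/
def frobeniusNorm {m n : ℕ} (M : Matrix (Fin m) (Fin n) ℝ) : ℝ := ‖M‖

end Norm

/-- Batch normalization without mean correction: `BN(M) = diag(M Mᵀ)^(-1/2) M`.
(A zero row stays zero; under Gaussian weights and a nonzero input this has probability zero.) -/
def batchNorm {d n : ℕ} (M : Matrix (Fin d) (Fin n) ℝ) : Matrix (Fin d) (Fin n) ℝ :=
  Matrix.diagonal (fun i => ((M * M.transpose) i i) ^ (-(1 / 2) : ℝ)) * M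

/-- The hidden representations: `H_0` is the input and
`H_{k+1} = (1/√d) BN(W_k H_k)`. -/
def hidden {d n : ℕ} (W : ℕ → Matrix (Fin d) (Fin d) ℝ) (H₀ : Matrix (Fin d) (Fin n) ℝ) :
    ℕ → Matrix (Fin d) (Fin n) ℝ
  | 0 => H₀
  | k + 1 => (1 / √(d : ℝ)) • batchNorm (W k * hidden W H₀ k)

/-- The `n`-th largest singular value `σ_n(H)` of a `d × n` matrix `H`, which is its minimum singular
value when `1 ≤ n ≤ d`. Mathlib lists singular values in decreasing order, starting at index `0`. -/
def sigmaMin {d n : ℕ} (H : Matrix (Fin d) (Fin n) ℝ) : ℝ :=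
  (Matrix.toEuclideanLin H).singularValues (n - 1)

/-- The Lyapunov function `V̂(H) = 1/n - σ_n(H)²`. -/
def VHat {d n : ℕ} (H : Matrix (Fin d) (Fin n) ℝ) : ℝ :=
  1 / (n : ℝ) - sigmaMin H ^ 2

/-- The depth average `(1/ℓ) ∑_{k=1}^ℓ V̂(H_k) (1/n - V̂(H_k))`. -/
def depthAverage {d n : ℕ} (W : ℕ → Matrix (Fin d) (Fin d) ℝ)
    (H₀ : Matrix (Fin d) (Fin n) ℝ) (ℓ : ℕ) : ℝ :=
  (1 / (ℓ : ℝ)) * ∑ k ∈ Finset.Icc 1 ℓ,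
    VHat (hidden W H₀ k) * (1 / (n : ℝ) - VHat (hidden W H₀ k))

end BNChain

end

noncomputable section

namespace BNChain

open Matrix

/-! Write s = σ_n(H)². With y_i = Hᵀ w_i and w_i the rows of the weight matrix, the Gram matrix of
the next layer is the average of the d rank-one matrices y_i y_iᵀ/|y_i|², which are i.i.d. for fixed
H. Each has Frobenius norm at most 1, so the average lies within mean-square Frobenius distance 1/d
of its expectation P (`integral_sumSq_gram_sub_le`), and passing from P to the average costs at most
1/√d in the mean of the least eigenvalue (`sub_sqrt_sumSq_le_sigmaMin_sq`).

It remains to bound P from below (`le_integral_normalized_quadratic`). Diagonalizing HᵀH with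
eigenvalues l_i turns xᵀPx into the mean of (a·z)²/Σ l_k z_k² for an n-dimensional Gaussian z. The
inequality q²/X ≥ 2qp - p²X with p = (c·z)/|z|² replaces this quotient by moments of z/|z| of degree
two and four, which rotation invariance makes explicit. Optimizing over c, with Σ l_k ≤ 1, gives
xᵀPx ≥ (1 + 2/n) s/(1 + 2s) for unit x. This exceeds s by 2s(1/n - s)/(1 + 2s) ≥ (2/3) s(1/n - s).

Since W_k is independent of H_k, the drift holds in expectation along the chain
(`integral_sigmaMin_sq_hidden_succ`). As V̂(1/n - V̂) = s(1/n - s), telescoping the drift bounds the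
depth average. -/

/-! ### Least singular value and perturbation of Gram matrices. -/

lemma euclidean_norm_sq {n : ℕ} (x : EuclideanSpace ℝ (Fin n)) :
    ‖x‖ ^ 2 = x.ofLp ⬝ᵥ x.ofLp := by
  rw [EuclideanSpace.real_norm_sq_eq, dotProduct]
  simp [sq]

lemma inner_adjoint_comp_self {d n : ℕ} (H : Matrix (Fin d) (Fin n) ℝ)
    (v : EuclideanSpace ℝ (Fin n)) :
    inner ℝ v ((LinearMap.adjoint (toEuclideanLin H) ∘ₗ toEuclideanLin H) v) =
      (H *ᵥ v.ofLp) ⬝ᵥ (H *ᵥ v.ofLp) := by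
  rw [LinearMap.comp_apply, LinearMap.adjoint_inner_right, real_inner_self_eq_norm_sq,
    euclidean_norm_sq]
  simp

/-- The quadratic form of `HᵀH` attains the value `σ_n(H)²` on the unit sphere. -/
lemma exists_mulVec_eq_sigmaMin_sq {d n : ℕ} (hn : 1 ≤ n) (H : Matrix (Fin d) (Fin n) ℝ) :
    ∃ v : Fin n → ℝ, v ⬝ᵥ v = 1 ∧ (H *ᵥ v) ⬝ᵥ (H *ᵥ v) = sigmaMin H ^ 2 := by
  have hT := (toEuclideanLin H).isSymmetric_adjoint_comp_self
  have hfr : Module.finrank ℝ (EuclideanSpace ℝ (Fin n)) = n := by simp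
  have hlt : n - 1 < n := by omega
  set b := hT.eigenvectorBasis hfr
  refine ⟨(b ⟨n - 1, hlt⟩).ofLp, ?_, ?_⟩
  · rw [← euclidean_norm_sq, b.norm_eq_one, one_pow]
  · rw [← inner_adjoint_comp_self, hT.apply_eigenvectorBasis hfr, inner_smul_right,
      real_inner_self_eq_norm_sq, b.norm_eq_one, sigmaMin,
      LinearMap.sq_singularValues_of_lt _ hfr hlt]
    simp

/-- `σ_n(H)²` bounds the quadratic form of `HᵀH` from below. -/
lemma sigmaMin_sq_mul_le {d n : ℕ} (hn : 1 ≤ n) (H : Matrix (Fin d) (Fin n) ℝ)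
    (v : Fin n → ℝ) : sigmaMin H ^ 2 * (v ⬝ᵥ v) ≤ (H *ᵥ v) ⬝ᵥ (H *ᵥ v) := by
  have hT := (toEuclideanLin H).isSymmetric_adjoint_comp_self
  have hfr : Module.finrank ℝ (EuclideanSpace ℝ (Fin n)) = n := by simp
  have hlt : n - 1 < n := by omega
  set b := hT.eigenvectorBasis hfr with hb
  set x : EuclideanSpace ℝ (Fin n) := WithLp.toLp 2 v with hx
  have h1 : (H *ᵥ v) ⬝ᵥ (H *ᵥ v) =
      ∑ i, hT.eigenvalues hfr i * (inner ℝ (b i) x) ^ 2 := by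
    rw [show v = x.ofLp from rfl, ← inner_adjoint_comp_self, ← b.sum_inner_mul_inner]
    refine Finset.sum_congr rfl fun i _ => ?_
    rw [← hT (b i) x, hT.apply_eigenvectorBasis hfr, inner_smul_left,
      real_inner_comm x (b i)]
    simp; ring
  have h2 : v ⬝ᵥ v = ∑ i, (inner ℝ (b i) x) ^ 2 := by
    rw [show v = x.ofLp from rfl, ← euclidean_norm_sq, b.sum_sq_inner_right]
  rw [h1, h2, Finset.mul_sum]
  refine Finset.sum_le_sum fun i _ => mul_le_mul_of_nonneg_right ?_ (sq_nonneg _)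
  rw [sigmaMin, LinearMap.sq_singularValues_of_lt _ hfr hlt]
  exact hT.eigenvalues_antitone hfr (Fin.mk_le_mk.2 (by omega) : i ≤ ⟨n - 1, hlt⟩)

/-- The squared Frobenius norm. -/
def sumSq {m n : ℕ} (M : Matrix (Fin m) (Fin n) ℝ) : ℝ := ∑ i, ∑ j, M i j ^ 2

lemma sumSq_nonneg {m n : ℕ} (M : Matrix (Fin m) (Fin n) ℝ) : 0 ≤ sumSq M :=
  Finset.sum_nonneg fun _ _ => Finset.sum_nonneg fun _ _ => sq_nonneg _

lemma sumSq_eq_frobeniusNorm_sq {m n : ℕ} (M : Matrix (Fin m) (Fin n) ℝ) :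
    sumSq M = frobeniusNorm M ^ 2 := by
  rw [frobeniusNorm, Matrix.frobenius_norm_def, ← Real.sqrt_eq_rpow, Real.sq_sqrt]
  · simp [sumSq]
  · positivity

lemma sumSq_eq_trace {m n : ℕ} (M : Matrix (Fin m) (Fin n) ℝ) :
    sumSq M = (Mᵀ * M).trace := by
  simp only [sumSq, trace, diag_apply, mul_apply, transpose_apply]
  rw [Finset.sum_comm]
  simp [sq]

/-- Testing the quadratic form on the basis vectors bounds every diagonal entry of HᵀH from below;
their sum is the squared Frobenius norm. -/
lemma nat_mul_sigmaMin_sq_le {d n : ℕ} (hn : 1 ≤ n) (H : Matrix (Fin d) (Fin n) ℝ) :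
    n * sigmaMin H ^ 2 ≤ sumSq H := by
  have h : ∀ j : Fin n, sigmaMin H ^ 2 ≤ ∑ i, H i j ^ 2 := fun j => by
    have := sigmaMin_sq_mul_le hn H (Pi.single j 1)
    rw [dotProduct_single_one, Pi.single_eq_same, mul_one, mulVec_single_one] at this
    simpa [dotProduct, sq] using this
  calc n * sigmaMin H ^ 2 = ∑ _j : Fin n, sigmaMin H ^ 2 := by simp
    _ ≤ ∑ j, ∑ i, H i j ^ 2 := Finset.sum_le_sum fun j _ => h j
    _ = sumSq H := Finset.sum_comm

lemma sigmaMin_sq_le_inv {d n : ℕ} (hn : 1 ≤ n) {H : Matrix (Fin d) (Fin n) ℝ}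
    (hH : sumSq H ≤ 1) : sigmaMin H ^ 2 ≤ 1 / n := by
  rw [le_div_iff₀ (by positivity), mul_comm]
  exact (nat_mul_sigmaMin_sq_le hn H).trans hH

lemma abs_dotProduct_mulVec_le {n : ℕ} (M : Matrix (Fin n) (Fin n) ℝ) {v : Fin n → ℝ}
    (hv : v ⬝ᵥ v = 1) : |v ⬝ᵥ (M *ᵥ v)| ≤ √(sumSq M) := by
  apply Real.abs_le_sqrt
  have h1 : ∑ i, v i ^ 2 = 1 := by simpa [dotProduct, sq] using hv
  have h2 : (v ⬝ᵥ (M *ᵥ v)) ^ 2 ≤ (∑ i, v i ^ 2) * ∑ i, (M *ᵥ v) i ^ 2 :=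
    Finset.sum_mul_sq_le_sq_mul_sq _ _ _
  refine h2.trans ?_
  rw [h1, one_mul]
  refine Finset.sum_le_sum fun i _ => ?_
  have h3 : (M *ᵥ v) i ^ 2 ≤ (∑ j, M i j ^ 2) * ∑ j, v j ^ 2 :=
    Finset.sum_mul_sq_le_sq_mul_sq Finset.univ (M i) v
  rwa [h1, mul_one] at h3

lemma mulVec_dotProduct_mulVec {d n : ℕ} (H : Matrix (Fin d) (Fin n) ℝ) (v : Fin n → ℝ) :
    (H *ᵥ v) ⬝ᵥ (H *ᵥ v) = v ⬝ᵥ ((Hᵀ * H) *ᵥ v) := by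
  rw [← mulVec_mulVec, dotProduct_mulVec v, vecMul_transpose]

/-- Perturbation bound for the least eigenvalue of a Gram matrix. -/
lemma sub_sqrt_sumSq_le_sigmaMin_sq {d n : ℕ} (hn : 1 ≤ n) (H : Matrix (Fin d) (Fin n) ℝ)
    (P : Matrix (Fin n) (Fin n) ℝ) {c : ℝ}
    (hP : ∀ v : Fin n → ℝ, v ⬝ᵥ v = 1 → c ≤ v ⬝ᵥ (P *ᵥ v)) :
    c - √(sumSq (Hᵀ * H - P)) ≤ sigmaMin H ^ 2 := by
  obtain ⟨v, hv, hHv⟩ := exists_mulVec_eq_sigmaMin_sq hn H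
  have h1 := abs_dotProduct_mulVec_le (Hᵀ * H - P) hv
  rw [sub_mulVec, dotProduct_sub, ← mulVec_dotProduct_mulVec, hHv] at h1
  have h2 := hP v hv
  have h3 := (abs_le.1 h1).1
  linarith

lemma abs_sigmaMin_sq_sub_le {d n : ℕ} (hn : 1 ≤ n) (H K : Matrix (Fin d) (Fin n) ℝ) :
    |sigmaMin H ^ 2 - sigmaMin K ^ 2| ≤ √(sumSq (Hᵀ * H - Kᵀ * K)) := by
  have key : ∀ H K : Matrix (Fin d) (Fin n) ℝ,
      sigmaMin K ^ 2 - √(sumSq (Hᵀ * H - Kᵀ * K)) ≤ sigmaMin H ^ 2 := fun H K =>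
    sub_sqrt_sumSq_le_sigmaMin_sq hn H _ fun v hv => by
      rw [← mulVec_dotProduct_mulVec]
      simpa [hv] using sigmaMin_sq_mul_le hn K v
  have hsymm : sumSq (Kᵀ * K - Hᵀ * H) = sumSq (Hᵀ * H - Kᵀ * K) := by
    simp only [sumSq, Matrix.sub_apply]
    exact Finset.sum_congr rfl fun i _ => Finset.sum_congr rfl fun j _ => by ring
  have h1 := key H K
  have h2 := key K H
  rw [hsymm] at h2
  rw [abs_le]
  constructor <;> linarith

/-- Serves to make `sigmaMin` squared measurable along the chain. -/
lemma continuous_sigmaMin_sq {d n : ℕ} (hn : 1 ≤ n) :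
    Continuous fun H : Matrix (Fin d) (Fin n) ℝ => sigmaMin H ^ 2 := by
  rw [continuous_iff_continuousAt]
  intro K
  rw [ContinuousAt, tendsto_iff_dist_tendsto_zero]
  have hc : Continuous fun H : Matrix (Fin d) (Fin n) ℝ => √(sumSq (Hᵀ * H - Kᵀ * K)) := by
    unfold sumSq
    refine Real.continuous_sqrt.comp (continuous_finsetSum _ fun i _ =>
      continuous_finsetSum _ fun j _ => Continuous.pow ?_ 2)
    exact ((continuous_id.matrix_transpose.matrix_mul continuous_id).sub
      continuous_const).matrix_elem i j
  have h0 : √(sumSq (Kᵀ * K - Kᵀ * K)) = 0 := by simp [sumSq]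
  refine squeeze_zero (fun _ => dist_nonneg) (fun H => ?_) (h0 ▸ hc.tendsto K)
  rw [Real.dist_eq]
  exact abs_sigmaMin_sq_sub_le hn H K

/-! ### Gaussian vectors, orthogonal invariance and reflections. -/

/-- The law of a vector of `m` independent centred Gaussian variables of variance `v`. -/
abbrev gaussianVec (m : ℕ) (v : NNReal) : Measure (Fin m → ℝ) :=
  Measure.pi fun _ => gaussianReal 0 v

/-- Moving A to the test vector as Aᵀ reduces the claim to the characteristic function of a product
measure. -/
lemma charFun_map_mulVec_gaussianVec {m k : ℕ} (v : NNReal) (A : Matrix (Fin k) (Fin m) ℝ)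
    (t : EuclideanSpace ℝ (Fin k)) :
    charFun (((gaussianVec m v).map (A *ᵥ ·)).map (WithLp.toLp 2)) t =
      Complex.exp (-(v * (t.ofLp ⬝ᵥ ((A * Aᵀ) *ᵥ t.ofLp)) / 2 : ℝ)) := by
  have hmeas : Measurable fun w : Fin m → ℝ => A *ᵥ w :=
    (Continuous.matrix_mulVec continuous_const continuous_id).measurable
  have h1 : charFun (((gaussianVec m v).map (A *ᵥ ·)).map (WithLp.toLp 2)) t =
      charFun ((gaussianVec m v).map (WithLp.toLp 2)) (WithLp.toLp 2 (Aᵀ *ᵥ t.ofLp)) := by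
    rw [charFun_apply, charFun_apply, integral_map (by fun_prop) (by fun_prop),
      integral_map (by fun_prop) (by fun_prop), integral_map (by fun_prop) (by fun_prop)]
    congr with w
    congr 3
    rw [EuclideanSpace.inner_toLp_toLp]
    rw [← WithLp.toLp_ofLp 2 t, EuclideanSpace.inner_toLp_toLp]
    simp only [star_trivial]
    rw [mulVec_transpose, ← dotProduct_mulVec]
  rw [h1, charFun_pi]
  simp_rw [charFun_gaussianReal, ← Complex.exp_sum]
  congr 1
  have h2 : t.ofLp ⬝ᵥ ((A * Aᵀ) *ᵥ t.ofLp) = ∑ i, (Aᵀ *ᵥ t.ofLp) i ^ 2 := by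
    have := mulVec_dotProduct_mulVec Aᵀ t.ofLp
    rw [transpose_transpose] at this
    rw [← this]
    simp [dotProduct, sq]
  rw [h2]
  push_cast
  rw [Finset.mul_sum, Finset.sum_div, ← Finset.sum_neg_distrib]
  refine Finset.sum_congr rfl fun i _ => ?_
  simp

/-- The law of `A w` for a centred isotropic Gaussian vector `w` depends only on `A Aᵀ`. -/
lemma map_mulVec_gaussianVec_eq {m m' k : ℕ} (v : NNReal) {A : Matrix (Fin k) (Fin m) ℝ}
    {B : Matrix (Fin k) (Fin m') ℝ} (h : A * Aᵀ = B * Bᵀ) :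
    (gaussianVec m v).map (A *ᵥ ·) = (gaussianVec m' v).map (B *ᵥ ·) := by
  have hA : Measurable fun w : Fin m → ℝ => A *ᵥ w :=
    (Continuous.matrix_mulVec continuous_const continuous_id).measurable
  have hB : Measurable fun w : Fin m' → ℝ => B *ᵥ w :=
    (Continuous.matrix_mulVec continuous_const continuous_id).measurable
  have := Measure.isProbabilityMeasure_map (μ := gaussianVec m v) hA.aemeasurable
  have := Measure.isProbabilityMeasure_map (μ := gaussianVec m' v) hB.aemeasurable
  apply (MeasurableEquiv.toLp 2 (Fin k → ℝ)).map_measurableEquiv_injective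
  apply Measure.ext_of_charFun
  ext t
  change charFun (((gaussianVec m v).map (A *ᵥ ·)).map (WithLp.toLp 2)) t =
    charFun (((gaussianVec m' v).map (B *ᵥ ·)).map (WithLp.toLp 2)) t
  rw [charFun_map_mulVec_gaussianVec, charFun_map_mulVec_gaussianVec, h]

lemma dotProduct_self_nonneg' {n : ℕ} (z : Fin n → ℝ) : 0 ≤ z ⬝ᵥ z :=
  Finset.sum_nonneg fun i _ => mul_self_nonneg (z i)

lemma dotProduct_sq_le {n : ℕ} (a z : Fin n → ℝ) : (a ⬝ᵥ z) ^ 2 ≤ (a ⬝ᵥ a) * (z ⬝ᵥ z) := by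
  have := Finset.sum_mul_sq_le_sq_mul_sq Finset.univ a z
  simpa [dotProduct, sq] using this

@[fun_prop]
lemma measurable_dotProduct {n : ℕ} {α : Type*} [MeasurableSpace α] {f g : α → Fin n → ℝ}
    (hf : Measurable f) (hg : Measurable g) : Measurable fun x => f x ⬝ᵥ g x := by
  unfold dotProduct
  fun_prop

lemma ae_dotProduct_self_ne_zero {n : ℕ} (hn : 1 ≤ n) {v : NNReal} (hv : v ≠ 0) :
    ∀ᵐ z ∂gaussianVec n v, z ⬝ᵥ z ≠ 0 := by
  have := nullSingletonClass_gaussianReal (μ := 0) hv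
  have : Nonempty (Fin n) := ⟨⟨0, hn⟩⟩
  have h : ∀ᵐ z ∂gaussianVec n v, z ≠ 0 := by
    rw [ae_iff]
    simp
  filter_upwards [h] with z hz
  rwa [Ne, dotProduct_self_eq_zero]

/-- The Householder reflection exchanging `a` and `b` when `a ⬝ᵥ a = b ⬝ᵥ b`. -/
def householder {n : ℕ} (a b : Fin n → ℝ) : Matrix (Fin n) (Fin n) ℝ :=
  1 - (2 / ((a - b) ⬝ᵥ (a - b))) • vecMulVec (a - b) (a - b)

/-- No hypothesis a ≠ b is needed: for a = b the coefficient 2/0 is 0 and the matrix is the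
identity. -/
lemma householder_mul_transpose {n : ℕ} (a b : Fin n → ℝ) :
    householder a b * (householder a b)ᵀ = 1 := by
  unfold householder
  set u := a - b
  set t := 2 / (u ⬝ᵥ u) with ht
  have h : t * t * (u ⬝ᵥ u) = 2 * t := by
    rcases eq_or_ne (u ⬝ᵥ u) 0 with h0 | h0
    · simp [ht, h0]
    · rw [ht]; field_simp
  have h' : (vecMulVec u u)ᵀ = vecMulVec u u := by
    ext i j; simp [vecMulVec_apply, mul_comm]
  have h'' : vecMulVec u u * vecMulVec u u = (u ⬝ᵥ u) • vecMulVec u u := by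
    ext i j
    simp only [mul_apply, vecMulVec_apply, Matrix.smul_apply, dotProduct, smul_eq_mul, Finset.sum_mul]
    exact Finset.sum_congr rfl fun k _ => by ring
  rw [transpose_sub, transpose_smul, h', transpose_one, sub_mul, mul_sub, mul_sub, one_mul,
    mul_one, one_mul, smul_mul_smul_comm, h'', smul_smul, h, two_mul, add_smul]
  abel

lemma householder_mulVec_dotProduct_self {n : ℕ} (a b z : Fin n → ℝ) :
    (householder a b *ᵥ z) ⬝ᵥ (householder a b *ᵥ z) = z ⬝ᵥ z := by
  rw [mulVec_dotProduct_mulVec, mul_eq_one_comm.1 (householder_mul_transpose a b), one_mulVec]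

lemma dotProduct_householder_mulVec {n : ℕ} {a b : Fin n → ℝ} (h : a ⬝ᵥ a = b ⬝ᵥ b)
    (z : Fin n → ℝ) : a ⬝ᵥ (householder a b *ᵥ z) = b ⬝ᵥ z := by
  unfold householder
  have hu : (a - b) ⬝ᵥ (a - b) = 2 * (a ⬝ᵥ (a - b)) := by
    simp only [dotProduct_sub, sub_dotProduct, dotProduct_comm b a]
    linarith
  have hv : vecMulVec (a - b) (a - b) *ᵥ z = ((a - b) ⬝ᵥ z) • (a - b) := by
    ext i
    simp only [mulVec, dotProduct, vecMulVec_apply, Pi.smul_apply, smul_eq_mul, Finset.sum_mul]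
    exact Finset.sum_congr rfl fun k _ => by ring
  rw [sub_mulVec, one_mulVec, smul_mulVec, hv, dotProduct_sub, dotProduct_smul, dotProduct_smul]
  rcases eq_or_ne ((a - b) ⬝ᵥ (a - b)) 0 with h0 | h0
  · have : a = b := sub_eq_zero.1 (dotProduct_self_eq_zero.1 h0)
    simp [this]
  · have h1 : a ⬝ᵥ (a - b) ≠ 0 := fun h2 => h0 (by rw [hu, h2, mul_zero])
    rw [hu, smul_eq_mul, smul_eq_mul]
    field_simp
    rw [sub_dotProduct]
    ring

/-! ### Moments of z/|z| for Gaussian z, up to degree four. -/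

section

variable {n : ℕ} {v : NNReal}

lemma integral_comp_orthogonal {Q : Matrix (Fin n) (Fin n) ℝ} (hQ : Q * Qᵀ = 1)
    {f : (Fin n → ℝ) → ℝ} (hf : Measurable f) :
    ∫ z, f (Q *ᵥ z) ∂gaussianVec n v = ∫ z, f z ∂gaussianVec n v := by
  have hmeas : Measurable fun w : Fin n → ℝ => Q *ᵥ w :=
    (Continuous.matrix_mulVec continuous_const continuous_id).measurable
  have h := map_mulVec_gaussianVec_eq (A := Q) (B := (1 : Matrix (Fin n) (Fin n) ℝ)) v (by simp [hQ])
  simp only [one_mulVec, Measure.map_id'] at h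
  rw [← integral_map (φ := fun w => Q *ᵥ w) hmeas.aemeasurable
    hf.aestronglyMeasurable, h]

/-- The degree-four directional moment of the uniform law on the sphere. -/
lemma integral_dotProduct_pow_four (i₀ : Fin n) (a : Fin n → ℝ) :
    ∫ z, (a ⬝ᵥ z) ^ 4 / (z ⬝ᵥ z) ^ 2 ∂gaussianVec n v =
      (a ⬝ᵥ a) ^ 2 * ∫ z, z i₀ ^ 4 / (z ⬝ᵥ z) ^ 2 ∂gaussianVec n v := by
  -- A multiple of a basis vector with the same length as a, so the reflection turns a·z into √(a·a)
  -- times a single coordinate.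
  set b : Fin n → ℝ := Pi.single i₀ √(a ⬝ᵥ a)
  have hab : a ⬝ᵥ a = b ⬝ᵥ b := by
    simp [b, Real.mul_self_sqrt (dotProduct_self_nonneg' a)]
  have h := integral_comp_orthogonal (v := v) (householder_mul_transpose a b)
    (f := fun z => (a ⬝ᵥ z) ^ 4 / (z ⬝ᵥ z) ^ 2) (by fun_prop)
  simp only [householder_mulVec_dotProduct_self, dotProduct_householder_mulVec hab] at h
  rw [← h, ← integral_const_mul]
  refine integral_congr_ae (ae_of_all _ fun z => ?_)
  have h4 : √(a ⬝ᵥ a) ^ 4 = (a ⬝ᵥ a) ^ 2 := by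
    rw [show √(a ⬝ᵥ a) ^ 4 = (√(a ⬝ᵥ a) ^ 2) ^ 2 by ring,
      Real.sq_sqrt (dotProduct_self_nonneg' a)]
  simp only [b, single_dotProduct, mul_pow, h4]
  ring

lemma integrable_sq_mul_sq_div (a b : Fin n → ℝ) :
    Integrable (fun z => (a ⬝ᵥ z) ^ 2 * (b ⬝ᵥ z) ^ 2 / (z ⬝ᵥ z) ^ 2) (gaussianVec n v) := by
  refine Integrable.of_bound (C := (a ⬝ᵥ a) * (b ⬝ᵥ b))
    (Measurable.aestronglyMeasurable (by fun_prop)) (ae_of_all _ fun z => ?_)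
  have h0 := dotProduct_self_nonneg' z
  rw [Real.norm_of_nonneg (by positivity)]
  refine div_le_of_le_mul₀ (by positivity)
    (mul_nonneg (dotProduct_self_nonneg' a) (dotProduct_self_nonneg' b)) ?_
  calc (a ⬝ᵥ z) ^ 2 * (b ⬝ᵥ z) ^ 2 ≤ ((a ⬝ᵥ a) * (z ⬝ᵥ z)) * ((b ⬝ᵥ b) * (z ⬝ᵥ z)) :=
        mul_le_mul (dotProduct_sq_le a z) (dotProduct_sq_le b z) (sq_nonneg _)
          (mul_nonneg (dotProduct_self_nonneg' a) h0)
    _ = _ := by ring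

lemma integrable_mul_div (a b : Fin n → ℝ) :
    Integrable (fun z => (a ⬝ᵥ z) * (b ⬝ᵥ z) / (z ⬝ᵥ z)) (gaussianVec n v) := by
  refine Integrable.of_bound (C := (a ⬝ᵥ a) + (b ⬝ᵥ b))
    (Measurable.aestronglyMeasurable (by fun_prop)) (ae_of_all _ fun z => ?_)
  have h0 := dotProduct_self_nonneg' z
  rw [norm_div, Real.norm_of_nonneg h0, Real.norm_eq_abs, abs_mul]
  refine div_le_of_le_mul₀ h0
    (add_nonneg (dotProduct_self_nonneg' a) (dotProduct_self_nonneg' b)) ?_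
  have h1 := dotProduct_sq_le a z
  have h2 := dotProduct_sq_le b z
  nlinarith [sq_nonneg (|a ⬝ᵥ z| - |b ⬝ᵥ z|), sq_abs (a ⬝ᵥ z), sq_abs (b ⬝ᵥ z), sq_nonneg (a ⬝ᵥ z),
    sq_nonneg (b ⬝ᵥ z)]

/-- Polarization, 12 p²q² = (p+q)⁴ + (p-q)⁴ - 2p⁴ - 2q⁴, reduces mixed moments to directional ones.
The single unknown moment is kept as a factor until `integral_pow_four_div`. -/
lemma integral_sq_mul_sq_div_aux (i₀ : Fin n) (a b : Fin n → ℝ) :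
    ∫ z, (a ⬝ᵥ z) ^ 2 * (b ⬝ᵥ z) ^ 2 / (z ⬝ᵥ z) ^ 2 ∂gaussianVec n v =
      ((a ⬝ᵥ a) * (b ⬝ᵥ b) + 2 * (a ⬝ᵥ b) ^ 2) *
        ((∫ z, z i₀ ^ 4 / (z ⬝ᵥ z) ^ 2 ∂gaussianVec n v) / 3) := by
  have hint : ∀ c : Fin n → ℝ,
      Integrable (fun z => (c ⬝ᵥ z) ^ 4 / (z ⬝ᵥ z) ^ 2) (gaussianVec n v) := fun c =>
    (integrable_sq_mul_sq_div c c).congr (ae_of_all _ fun z => by ring_nf)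
  have hz : ∀ z : Fin n → ℝ, (a ⬝ᵥ z) ^ 2 * (b ⬝ᵥ z) ^ 2 / (z ⬝ᵥ z) ^ 2 =
      (((a + b) ⬝ᵥ z) ^ 4 / (z ⬝ᵥ z) ^ 2 + ((a - b) ⬝ᵥ z) ^ 4 / (z ⬝ᵥ z) ^ 2
        - (2 * ((a ⬝ᵥ z) ^ 4 / (z ⬝ᵥ z) ^ 2) + 2 * ((b ⬝ᵥ z) ^ 4 / (z ⬝ᵥ z) ^ 2))) / 12 := fun z => by
    rw [add_dotProduct, sub_dotProduct]; ring
  simp_rw [hz]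
  have hadd : ∀ c : Fin n → ℝ, ∀ d : Fin n → ℝ, Integrable (fun z => (c ⬝ᵥ z) ^ 4 / (z ⬝ᵥ z) ^ 2 +
      (d ⬝ᵥ z) ^ 4 / (z ⬝ᵥ z) ^ 2) (gaussianVec n v) := fun c d => (hint c).add (hint d)
  simp_rw [← mul_add]
  rw [integral_div, integral_sub (hadd _ _) ((hadd _ _).const_mul _), integral_const_mul,
    integral_add (hint _) (hint _), integral_add (hint _) (hint _)]
  simp only [integral_dotProduct_pow_four i₀]
  simp only [add_dotProduct, sub_dotProduct, dotProduct_add, dotProduct_sub, dotProduct_comm b a]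
  ring

lemma integral_sq_mul_diagonal_div_aux (i₀ : Fin n) (c l : Fin n → ℝ) :
    ∫ z, (c ⬝ᵥ z) ^ 2 * (∑ k, l k * z k ^ 2) / (z ⬝ᵥ z) ^ 2 ∂gaussianVec n v =
      ((c ⬝ᵥ c) * (∑ k, l k) + 2 * ∑ k, l k * c k ^ 2) *
        ((∫ z, z i₀ ^ 4 / (z ⬝ᵥ z) ^ 2 ∂gaussianVec n v) / 3) := by
  have hz : ∀ z : Fin n → ℝ, (c ⬝ᵥ z) ^ 2 * (∑ k, l k * z k ^ 2) / (z ⬝ᵥ z) ^ 2 =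
      ∑ k, l k * ((c ⬝ᵥ z) ^ 2 * (Pi.single k 1 ⬝ᵥ z) ^ 2 / (z ⬝ᵥ z) ^ 2) := fun z => by
    rw [Finset.mul_sum, Finset.sum_div]
    exact Finset.sum_congr rfl fun k _ => by rw [single_dotProduct, one_mul]; ring
  simp_rw [hz]
  rw [integral_finsetSum _ fun k _ => (integrable_sq_mul_sq_div _ _).const_mul _]
  simp_rw [integral_const_mul, integral_sq_mul_sq_div_aux i₀]
  simp only [dotProduct_single, Pi.single_eq_same, mul_one]
  rw [Finset.mul_sum, Finset.mul_sum, ← Finset.sum_add_distrib, Finset.sum_mul]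
  exact Finset.sum_congr rfl fun k _ => by ring

lemma integral_sq_div_aux (hv : v ≠ 0) (i₀ : Fin n) (c : Fin n → ℝ) :
    ∫ z, (c ⬝ᵥ z) ^ 2 / (z ⬝ᵥ z) ∂gaussianVec n v =
      (c ⬝ᵥ c) * (n + 2) * ((∫ z, z i₀ ^ 4 / (z ⬝ᵥ z) ^ 2 ∂gaussianVec n v) / 3) := by
  -- With all weights equal to 1 the diagonal form is |z|² and cancels one power of the denominator,
  -- so degree four yields degree two.
  have h := integral_sq_mul_diagonal_div_aux (v := v) i₀ c (fun _ => 1)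
  have hc : ∑ k, (1 : ℝ) * c k ^ 2 = c ⬝ᵥ c := by simp [dotProduct, sq]
  rw [hc] at h
  rw [show (c ⬝ᵥ c) * ((n : ℝ) + 2) = (c ⬝ᵥ c) * (∑ _k : Fin n, 1) + 2 * (c ⬝ᵥ c) by simp; ring, ← h]
  refine integral_congr_ae ?_
  filter_upwards [ae_dotProduct_self_ne_zero i₀.pos hv] with z hz
  rw [show ∑ k, (1 : ℝ) * z k ^ 2 = z ⬝ᵥ z by simp [dotProduct, sq]]
  field_simp

/-- The unknown moment is fixed by normalization: the quotients z_k²/|z|² sum to 1 almost surely. -/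
lemma integral_pow_four_div (hv : v ≠ 0) (i₀ : Fin n) :
    (∫ z, z i₀ ^ 4 / (z ⬝ᵥ z) ^ 2 ∂gaussianVec n v) / 3 = 1 / (n * (n + 2)) := by
  have hn : (0 : ℝ) < n := by exact_mod_cast i₀.pos
  have h : ∑ k : Fin n, ∫ z, (Pi.single k 1 ⬝ᵥ z) ^ 2 / (z ⬝ᵥ z) ∂gaussianVec n v = 1 := by
    rw [← integral_finsetSum]
    · calc _ = ∫ _z, (1 : ℝ) ∂gaussianVec n v := by
            refine integral_congr_ae ?_
            filter_upwards [ae_dotProduct_self_ne_zero i₀.pos hv] with z hz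
            rw [← Finset.sum_div]
            simp only [single_dotProduct, one_mul]
            rw [show ∑ k, z k ^ 2 = z ⬝ᵥ z by simp [dotProduct, sq], div_self hz]
        _ = 1 := by simp
    · intro k _
      exact (integrable_mul_div (Pi.single k 1) (Pi.single k 1)).congr
        (ae_of_all _ fun z => by simp only [sq])
  simp_rw [integral_sq_div_aux hv i₀] at h
  simp only [single_dotProduct, Pi.single_eq_same, mul_one, Finset.sum_const, Finset.card_univ,
    Fintype.card_fin, nsmul_eq_mul, one_mul] at h
  rw [eq_div_iff (by positivity)]
  linarith

lemma integral_sq_mul_diagonal_div (hn : 1 ≤ n) (hv : v ≠ 0) (c l : Fin n → ℝ) :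
    ∫ z, (c ⬝ᵥ z) ^ 2 * (∑ k, l k * z k ^ 2) / (z ⬝ᵥ z) ^ 2 ∂gaussianVec n v =
      ((c ⬝ᵥ c) * (∑ k, l k) + 2 * ∑ k, l k * c k ^ 2) / (n * (n + 2)) := by
  rw [integral_sq_mul_diagonal_div_aux ⟨0, hn⟩, integral_pow_four_div hv]
  ring

lemma integrable_sq_mul_diagonal_div (c l : Fin n → ℝ) :
    Integrable (fun z => (c ⬝ᵥ z) ^ 2 * (∑ k, l k * z k ^ 2) / (z ⬝ᵥ z) ^ 2)
      (gaussianVec n v) := by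
  refine (integrable_finsetSum Finset.univ fun k _ =>
    (integrable_sq_mul_sq_div (v := v) c (Pi.single k 1)).const_mul (l k)).congr
    (ae_of_all _ fun z => ?_)
  simp only [single_dotProduct, one_mul, Finset.mul_sum, Finset.sum_div]
  exact Finset.sum_congr rfl fun k _ => by ring

lemma integral_mul_div (hn : 1 ≤ n) (hv : v ≠ 0) (a b : Fin n → ℝ) :
    ∫ z, (a ⬝ᵥ z) * (b ⬝ᵥ z) / (z ⬝ᵥ z) ∂gaussianVec n v = (a ⬝ᵥ b) / n := by
  have hn' : (0 : ℝ) < n := by exact_mod_cast hn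
  have hsq : ∀ c : Fin n → ℝ, ∫ z, (c ⬝ᵥ z) ^ 2 / (z ⬝ᵥ z) ∂gaussianVec n v = (c ⬝ᵥ c) / n :=
    fun c => by
      rw [integral_sq_div_aux hv ⟨0, hn⟩, integral_pow_four_div hv]
      field_simp
  have hint : ∀ c : Fin n → ℝ,
      Integrable (fun z => (c ⬝ᵥ z) ^ 2 / (z ⬝ᵥ z)) (gaussianVec n v) := fun c =>
    (integrable_mul_div c c).congr (ae_of_all _ fun z => by simp only [sq])
  have hz : ∀ z : Fin n → ℝ, (a ⬝ᵥ z) * (b ⬝ᵥ z) / (z ⬝ᵥ z) =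
      (((a + b) ⬝ᵥ z) ^ 2 / (z ⬝ᵥ z) - ((a - b) ⬝ᵥ z) ^ 2 / (z ⬝ᵥ z)) / 4 := fun z => by
    rw [add_dotProduct, sub_dotProduct]; ring
  simp_rw [hz]
  rw [integral_div, integral_sub (hint _) (hint _), hsq, hsq]
  simp only [add_dotProduct, sub_dotProduct, dotProduct_add, dotProduct_sub, dotProduct_comm b a]
  ring

end

/-! ### Lower bound for the mean Gram matrix. -/

section

variable {d n : ℕ} {v : NNReal}

lemma exists_orthogonal_diagonalization {S : Matrix (Fin n) (Fin n) ℝ} (hS : S.IsHermitian) :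
    ∃ (U : Matrix (Fin n) (Fin n) ℝ) (l : Fin n → ℝ),
      Uᵀ * U = 1 ∧ U * Uᵀ = 1 ∧ S = U * diagonal l * Uᵀ := by
  refine ⟨hS.eigenvectorUnitary, hS.eigenvalues, ?_, ?_, ?_⟩
  · exact Unitary.coe_star_mul_self hS.eigenvectorUnitary
  · exact Unitary.coe_mul_star_self hS.eigenvectorUnitary
  · exact hS.spectral_theorem

/-- This is (x - pX)² ≥ 0 divided by X. It removes X from the denominator for any trial value p. For
X = 0 both sides vanish, the quotient by convention. -/
lemma two_mul_sub_le_sq_div {x X : ℝ} (p : ℝ) (hX : 0 ≤ X) (h : X = 0 → x = 0) :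
    2 * x * p - p ^ 2 * X ≤ x ^ 2 / X := by
  rcases hX.eq_or_lt with h0 | h0
  · simp [h h0.symm, ← h0]
  · rw [le_div_iff₀ h0]
    nlinarith [sq_nonneg (x - p * X)]

lemma integrable_sq_div_diagonal {a l : Fin n → ℝ} {C : ℝ} (hC : 0 ≤ C) (hl : ∀ i, 0 ≤ l i)
    (ha : ∀ z, (a ⬝ᵥ z) ^ 2 ≤ C * ∑ k, l k * z k ^ 2) :
    Integrable (fun z => (a ⬝ᵥ z) ^ 2 / ∑ k, l k * z k ^ 2) (gaussianVec n v) := by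
  refine Integrable.of_bound (C := C)
    (Measurable.aestronglyMeasurable (by fun_prop)) (ae_of_all _ fun z => ?_)
  have h0 : 0 ≤ ∑ k, l k * z k ^ 2 :=
    Finset.sum_nonneg fun k _ => mul_nonneg (hl k) (sq_nonneg _)
  rw [Real.norm_of_nonneg (by positivity)]
  exact div_le_of_le_mul₀ h0 hC (ha z)

/-- Lower bound for a normalized Gaussian quadratic form, with a free test vector `c`. -/
lemma le_integral_sq_div_diagonal (hn : 1 ≤ n) (hv : v ≠ 0) {a l : Fin n → ℝ} {C : ℝ}
    (hC : 0 ≤ C) (hl : ∀ i, 0 ≤ l i) (ha : ∀ z, (a ⬝ᵥ z) ^ 2 ≤ C * ∑ k, l k * z k ^ 2)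
    (c : Fin n → ℝ) :
    2 * ((a ⬝ᵥ c) / n) - ((c ⬝ᵥ c) * (∑ k, l k) + 2 * ∑ k, l k * c k ^ 2) / (n * (n + 2)) ≤
      ∫ z, (a ⬝ᵥ z) ^ 2 / ∑ k, l k * z k ^ 2 ∂gaussianVec n v := by
  rw [← integral_mul_div hn hv, ← integral_sq_mul_diagonal_div hn hv, ← integral_const_mul,
    ← integral_sub ((integrable_mul_div _ _).const_mul _) (integrable_sq_mul_diagonal_div _ _)]
  refine integral_mono (((integrable_mul_div _ _).const_mul _).sub
    (integrable_sq_mul_diagonal_div _ _)) (integrable_sq_div_diagonal hC hl ha) fun z => ?_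
  have h0 : 0 ≤ ∑ k, l k * z k ^ 2 :=
    Finset.sum_nonneg fun k _ => mul_nonneg (hl k) (sq_nonneg _)
  -- The trial value (c·z)/|z|² has degree -1 in z, so both terms become functions of z/|z| with
  -- known integrals.
  have := two_mul_sub_le_sq_div (x := a ⬝ᵥ z) ((c ⬝ᵥ z) / (z ⬝ᵥ z)) h0 fun h => by
    have := ha z
    rw [h, mul_zero] at this
    exact pow_eq_zero_iff two_ne_zero |>.1 (le_antisymm this (sq_nonneg _))
  refine le_trans (le_of_eq ?_) this
  rw [div_pow]
  ring

lemma mul_div_add_mono {s t : ℝ} (hs : 0 ≤ s) (hst : s ≤ t) :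
    s / (1 + 2 * s) ≤ t / (1 + 2 * t) := by
  rw [div_le_div_iff₀ (by linarith) (by linarith)]
  linarith

/-- Lower bound for the quadratic form of `E[y yᵀ/|y|²]`, where `y = Hᵀ w` with `w` Gaussian. -/
lemma le_integral_normalized_quadratic (hn : 1 ≤ n) (hv : v ≠ 0) {H : Matrix (Fin d) (Fin n) ℝ}
    {s : ℝ} (hs0 : 0 ≤ s) (hs : ∀ x : Fin n → ℝ, s * (x ⬝ᵥ x) ≤ x ⬝ᵥ ((Hᵀ * H) *ᵥ x))
    (htr : sumSq H ≤ 1) {x : Fin n → ℝ} (hx : x ⬝ᵥ x = 1) :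
    (n + 2) / n * (s / (1 + 2 * s)) ≤
      ∫ w, (x ⬝ᵥ (Hᵀ *ᵥ w)) ^ 2 / ((Hᵀ *ᵥ w) ⬝ᵥ (Hᵀ *ᵥ w)) ∂gaussianVec d v := by
  have hn' : (0 : ℝ) < n := by exact_mod_cast hn
  obtain ⟨U, l, hU, hU', hS⟩ := exists_orthogonal_diagonalization (S := Hᵀ * H)
    (isHermitian_conjTranspose_mul_self H)
  have hsl : ∀ i, s ≤ l i := fun i => by
    have h := hs (U *ᵥ Pi.single i 1)
    rw [hS, mulVec_dotProduct_mulVec, hU, ← mulVec_mulVec, ← mulVec_mulVec, mulVec_mulVec _ Uᵀ U, hU,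
      one_mulVec, dotProduct_mulVec, vecMul_mulVec] at h
    simpa [hU] using h
  have hl : ∀ i, 0 ≤ l i := fun i => hs0.trans (hsl i)
  have htrl : ∑ k, l k ≤ 1 := by
    rw [sumSq_eq_trace, hS, mul_assoc, trace_mul_comm, mul_assoc, hU, mul_one,
      trace_diagonal] at htr
    exact htr
  -- B is an n × n square root factor, BBᵀ = HᵀH; hence Hᵀw with w in dimension d has the law of Bz
  -- with z in dimension n.
  set B := U * diagonal fun i => √(l i)
  have hB : Hᵀ * Hᵀᵀ = B * Bᵀ := by
    rw [transpose_transpose, hS, transpose_mul, diagonal_transpose, mul_assoc, mul_assoc,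
      ← mul_assoc (diagonal _), diagonal_mul_diagonal]
    simp only [Real.mul_self_sqrt (hl _)]
  have hlaw := map_mulVec_gaussianVec_eq v hB
  have hmeas : ∀ {m : ℕ} (A : Matrix (Fin n) (Fin m) ℝ), Measurable fun w : Fin m → ℝ => A *ᵥ w :=
    fun A => (Continuous.matrix_mulVec continuous_const continuous_id).measurable
  set x' := Uᵀ *ᵥ x
  have hx' : ∑ i, x' i ^ 2 = 1 := by
    have : x' ⬝ᵥ x' = 1 := by
      rw [mulVec_dotProduct_mulVec, transpose_transpose, hU', one_mulVec, hx]
    simpa [dotProduct, sq] using this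
  set a : Fin n → ℝ := fun i => √(l i) * x' i
  have hxB : ∀ z, x ⬝ᵥ (B *ᵥ z) = a ⬝ᵥ z := fun z => by
    rw [← mulVec_mulVec, dotProduct_mulVec, ← mulVec_transpose]
    simp only [dotProduct, mulVec_diagonal, a, x']
    exact Finset.sum_congr rfl fun i _ => by ring
  have hBB : ∀ z, (B *ᵥ z) ⬝ᵥ (B *ᵥ z) = ∑ k, l k * z k ^ 2 := fun z => by
    rw [mulVec_dotProduct_mulVec, transpose_mul, mul_assoc, ← mul_assoc Uᵀ, hU, one_mul,
      diagonal_transpose, diagonal_mul_diagonal]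
    simp only [Real.mul_self_sqrt (hl _), dotProduct, mulVec_diagonal]
    exact Finset.sum_congr rfl fun i _ => by ring
  have hint : ∫ w, (x ⬝ᵥ (Hᵀ *ᵥ w)) ^ 2 / ((Hᵀ *ᵥ w) ⬝ᵥ (Hᵀ *ᵥ w)) ∂gaussianVec d v =
      ∫ z, (a ⬝ᵥ z) ^ 2 / ∑ k, l k * z k ^ 2 ∂gaussianVec n v := by
    have hf : Measurable fun y : Fin n → ℝ => (x ⬝ᵥ y) ^ 2 / (y ⬝ᵥ y) := by fun_prop
    rw [← integral_map (φ := fun w : Fin d → ℝ => Hᵀ *ᵥ w) (hmeas _).aemeasurable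
      hf.aestronglyMeasurable, hlaw, integral_map (hmeas _).aemeasurable hf.aestronglyMeasurable]
    simp only [hxB, hBB]
  have ha : ∀ z, (a ⬝ᵥ z) ^ 2 ≤ 1 * ∑ k, l k * z k ^ 2 := fun z => by
    rw [← hxB, ← hBB, ← hx]
    exact dotProduct_sq_le _ _
  rw [hint]
  -- Once Σ l_k is replaced by its bound 1, the lower bound is 2(a·c)/n - Σ (1 + 2l_i)c_i²/(n(n+2));
  -- this c, with c_i = (n+2)a_i/(1 + 2l_i), is its maximizer.
  refine le_trans ?_ (le_integral_sq_div_diagonal hn hv zero_le_one hl ha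
    fun i => (n + 2) * (√(l i) * x' i / (1 + 2 * l i)))
  set c : Fin n → ℝ := fun i => (n + 2) * (√(l i) * x' i / (1 + 2 * l i)) with hc
  have hpos : ∀ i, 0 < 1 + 2 * l i := fun i => by linarith [hl i]
  set T := ∑ i, l i * x' i ^ 2 / (1 + 2 * l i) with hT
  have hac : a ⬝ᵥ c = (n + 2) * T := by
    rw [hT, Finset.mul_sum]
    refine Finset.sum_congr rfl fun i _ => ?_
    have h := Real.mul_self_sqrt (hl i)
    calc _ = (n + 2) * ((√(l i) * √(l i)) * x' i ^ 2 / (1 + 2 * l i)) := by simp only [a, hc]; ring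
      _ = _ := by rw [h]
  have hcc : (c ⬝ᵥ c) + 2 * ∑ k, l k * c k ^ 2 = (n + 2) ^ 2 * T := by
    rw [hT, Finset.mul_sum, Finset.mul_sum, dotProduct, ← Finset.sum_add_distrib]
    refine Finset.sum_congr rfl fun i _ => ?_
    have h := Real.mul_self_sqrt (hl i)
    have h2 := (hpos i).ne'
    calc _ = (n + 2) ^ 2 * ((√(l i) * √(l i)) * x' i ^ 2 * (1 + 2 * l i) / (1 + 2 * l i) ^ 2) := by
          simp only [hc]; field_simp
      _ = _ := by rw [h]; field_simp
  have hcc0 : (c ⬝ᵥ c) * ∑ k, l k ≤ c ⬝ᵥ c :=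
    mul_le_of_le_one_right (dotProduct_self_nonneg' c) htrl
  have hTs : s / (1 + 2 * s) ≤ T := by
    calc s / (1 + 2 * s) = ∑ i, s / (1 + 2 * s) * x' i ^ 2 := by rw [← Finset.mul_sum, hx', mul_one]
      _ ≤ T := by
        refine Finset.sum_le_sum fun i _ => ?_
        rw [mul_div_right_comm]
        exact mul_le_mul_of_nonneg_right (mul_div_add_mono hs0 (hsl i)) (sq_nonneg _)
  rw [hac]
  calc (n + 2) / n * (s / (1 + 2 * s)) ≤ (n + 2) / n * T :=
        mul_le_mul_of_nonneg_left hTs (by positivity)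
    _ = 2 * ((n + 2) * T / n) - (n + 2) ^ 2 * T / (n * (n + 2)) := by field_simp; ring
    _ ≤ _ := by
      rw [← hcc]
      gcongr

/-- The difference of the right side and s is exactly 2s(1/n - s)/(1 + 2s), and 1 + 2s ≤ 3 because s
≤ 1/n ≤ 1. This is the origin of the factor 2/3. -/
lemma drift_le {s : ℝ} (hn : 1 ≤ n) (hs0 : 0 ≤ s) (hs : s ≤ 1 / n) :
    s + 2 / 3 * (s * (1 / n - s)) ≤ (n + 2) / n * (s / (1 + 2 * s)) := by
  have hn' : (1 : ℝ) ≤ n := by exact_mod_cast hn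
  set t : ℝ := 1 / n with ht
  have h1 : ((n : ℝ) + 2) / n = 1 + 2 * t := by rw [ht]; field_simp
  have ht1 : t ≤ 1 := by rw [ht, div_le_one (by linarith)]; exact hn'
  rw [h1, ← mul_div_assoc, le_div_iff₀ (by linarith)]
  have h2 : 0 ≤ s * (t - s) := mul_nonneg hs0 (by linarith)
  nlinarith [mul_nonneg h2 (by linarith : (0 : ℝ) ≤ 1 - s)]

end

/-! ### The Gram matrix of one layer. -/

section

variable {d n : ℕ} {v : NNReal}

/-- One layer of the batch-normalized linear network. -/
def layer (A : Matrix (Fin d) (Fin d) ℝ) (H : Matrix (Fin d) (Fin n) ℝ) :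
    Matrix (Fin d) (Fin n) ℝ :=
  (1 / √(d : ℝ)) • batchNorm (A * H)

/-- The entries of `y yᵀ / |y|²` for `y = Hᵀ w`. -/
def rowGram (H : Matrix (Fin d) (Fin n) ℝ) (a b : Fin n) (w : Fin d → ℝ) : ℝ :=
  (Hᵀ *ᵥ w) a * (Hᵀ *ᵥ w) b / ((Hᵀ *ᵥ w) ⬝ᵥ (Hᵀ *ᵥ w))

lemma batchNorm_apply (M : Matrix (Fin d) (Fin n) ℝ) (i : Fin d) (j : Fin n) :
    batchNorm M i j = (M i ⬝ᵥ M i) ^ (-(1 / 2) : ℝ) * M i j := by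
  rw [batchNorm, diagonal_mul]
  rfl

/-- Row i of AH is Hᵀ applied to row i of A, and normalization contributes the factor 1/|y|². A zero
row gives 0 on both sides, by the conventions for `rpow` and division at 0. -/
lemma gram_layer_apply (A : Matrix (Fin d) (Fin d) ℝ) (H : Matrix (Fin d) (Fin n) ℝ)
    (a b : Fin n) :
    ((layer A H)ᵀ * layer A H) a b = (∑ i, rowGram H a b (A i)) / d := by
  have hd : (1 / √(d : ℝ)) * (1 / √(d : ℝ)) = 1 / d := by
    rw [div_mul_div_comm, one_mul, Real.mul_self_sqrt (Nat.cast_nonneg d)]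
  have hrow : ∀ i, (A * H) i = Hᵀ *ᵥ A i := fun i => by
    ext j
    simp [mul_apply, mulVec, dotProduct, mul_comm]
  rw [mul_apply]
  simp only [transpose_apply, layer, Matrix.smul_apply, smul_eq_mul, batchNorm_apply]
  rw [Finset.sum_div]
  refine Finset.sum_congr rfl fun i _ => ?_
  rw [hrow, rowGram]
  set y := Hᵀ *ᵥ A i
  have h0 := dotProduct_self_nonneg' y
  have hp : (y ⬝ᵥ y) ^ (-(1 / 2) : ℝ) * (y ⬝ᵥ y) ^ (-(1 / 2) : ℝ) = (y ⬝ᵥ y)⁻¹ := by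
    rw [Real.rpow_neg h0, ← Real.sqrt_eq_rpow, ← mul_inv, Real.mul_self_sqrt h0]
  calc _ = (1 / √(d : ℝ)) * (1 / √(d : ℝ)) *
        ((y ⬝ᵥ y) ^ (-(1 / 2) : ℝ) * (y ⬝ᵥ y) ^ (-(1 / 2) : ℝ)) * (y a * y b) := by ring
    _ = _ := by rw [hd, hp]; ring

lemma measurable_rowGram (H : Matrix (Fin d) (Fin n) ℝ) (a b : Fin n) :
    Measurable (rowGram H a b) := by
  have h : Measurable fun w : Fin d → ℝ => Hᵀ *ᵥ w :=
    (Continuous.matrix_mulVec continuous_const continuous_id).measurable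
  unfold rowGram
  fun_prop

/-- The squared Frobenius norm of yyᵀ/|y|² is 1, except for y = 0, where the convention makes it 0.
-/
lemma sum_sq_rowGram_le_one (H : Matrix (Fin d) (Fin n) ℝ) (w : Fin d → ℝ) :
    ∑ a, ∑ b, rowGram H a b w ^ 2 ≤ 1 := by
  unfold rowGram
  set y := Hᵀ *ᵥ w
  have h : ∑ a, ∑ b, (y a * y b / (y ⬝ᵥ y)) ^ 2 = ((y ⬝ᵥ y) / (y ⬝ᵥ y)) ^ 2 := by
    simp_rw [div_pow, mul_pow, ← Finset.sum_div]
    congr 1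
    rw [← Finset.sum_mul_sum]
    simp only [dotProduct, sq]
  rw [h]
  exact pow_le_one₀ (div_nonneg (dotProduct_self_nonneg' y) (dotProduct_self_nonneg' y))
    (div_self_le_one _)

lemma rowGram_sq_le_one (H : Matrix (Fin d) (Fin n) ℝ) (a b : Fin n) (w : Fin d → ℝ) :
    rowGram H a b w ^ 2 ≤ 1 := by
  refine le_trans ?_ (sum_sq_rowGram_le_one H w)
  refine le_trans ?_ (Finset.single_le_sum (f := fun a => ∑ b, rowGram H a b w ^ 2)
    (fun _ _ => Finset.sum_nonneg fun _ _ => sq_nonneg _) (Finset.mem_univ a))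
  exact Finset.single_le_sum (f := fun b => rowGram H a b w ^ 2) (fun _ _ => sq_nonneg _)
    (Finset.mem_univ b)

lemma sumSq_layer_le_one (A : Matrix (Fin d) (Fin d) ℝ) (H : Matrix (Fin d) (Fin n) ℝ) :
    sumSq (layer A H) ≤ 1 := by
  rw [sumSq_eq_trace]
  simp only [trace, diag_apply, gram_layer_apply]
  rw [← Finset.sum_div, Finset.sum_comm]
  have h : ∀ i, ∑ a, rowGram H a a (A i) ≤ 1 := fun i => by
    unfold rowGram
    rw [← Finset.sum_div]
    exact div_self_le_one _
  refine div_le_one_of_le₀ ?_ (Nat.cast_nonneg d)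
  exact (Finset.sum_le_sum fun i _ => h i).trans (by simp)

/-- The mean Gram matrix of one layer. -/
def meanGram (v : NNReal) (H : Matrix (Fin d) (Fin n) ℝ) : Matrix (Fin n) (Fin n) ℝ :=
  Matrix.of fun a b => ∫ w, rowGram H a b w ∂gaussianVec d v

lemma abs_rowGram_le_one (H : Matrix (Fin d) (Fin n) ℝ) (a b : Fin n) (w : Fin d → ℝ) :
    |rowGram H a b w| ≤ 1 :=
  (sq_le_one_iff_abs_le_one _).1 (rowGram_sq_le_one H a b w)

lemma memLp_rowGram_comp {Ω : Type*} [MeasurableSpace Ω] {μ : Measure Ω} [IsFiniteMeasure μ]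
    (H : Matrix (Fin d) (Fin n) ℝ) (a b : Fin n) {X : Ω → Fin d → ℝ} (hX : Measurable X)
    (p : ENNReal) : MemLp (fun ω => rowGram H a b (X ω)) p μ :=
  MemLp.of_bound ((measurable_rowGram H a b).comp hX).aestronglyMeasurable 1
    (ae_of_all _ fun ω => abs_rowGram_le_one H a b (X ω))

lemma dotProduct_meanGram_mulVec (H : Matrix (Fin d) (Fin n) ℝ) (x : Fin n → ℝ) :
    x ⬝ᵥ (meanGram v H *ᵥ x) =
      ∫ w, (x ⬝ᵥ (Hᵀ *ᵥ w)) ^ 2 / ((Hᵀ *ᵥ w) ⬝ᵥ (Hᵀ *ᵥ w)) ∂gaussianVec d v := by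
  have hint : ∀ a b, Integrable (rowGram H a b) (gaussianVec d v) := fun a b =>
    (memLp_rowGram_comp H a b measurable_id 1).integrable le_rfl
  have hw : ∀ w, (x ⬝ᵥ (Hᵀ *ᵥ w)) ^ 2 / ((Hᵀ *ᵥ w) ⬝ᵥ (Hᵀ *ᵥ w)) =
      ∑ a, ∑ b, x a * x b * rowGram H a b w := fun w => by
    rw [sq, dotProduct, Finset.sum_mul_sum, Finset.sum_div]
    refine Finset.sum_congr rfl fun a _ => ?_
    rw [Finset.sum_div]
    exact Finset.sum_congr rfl fun b _ => by rw [rowGram]; ring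
  simp_rw [hw]
  rw [integral_finsetSum _ fun a _ => integrable_finsetSum _ fun b _ => (hint a b).const_mul _]
  simp only [dotProduct, mulVec, meanGram, of_apply]
  refine Finset.sum_congr rfl fun a _ => ?_
  rw [integral_finsetSum _ fun b _ => (hint a b).const_mul _, Finset.mul_sum]
  refine Finset.sum_congr rfl fun b _ => ?_
  rw [integral_const_mul]
  ring

lemma measurable_sigmaMin_sq_comp {α : Type*} [MeasurableSpace α] (hn : 1 ≤ n)
    {f : α → Matrix (Fin d) (Fin n) ℝ} (hf : ∀ i j, Measurable fun x => f x i j) :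
    Measurable fun x => sigmaMin (f x) ^ 2 := by
  have h : Continuous fun H : Fin d → Fin n → ℝ => sigmaMin (Matrix.of H) ^ 2 :=
    continuous_sigmaMin_sq hn
  exact h.measurable.comp (measurable_pi_lambda _ fun i => measurable_pi_lambda _ fun j => hf i j)

lemma measurable_layer_apply {α : Type*} [MeasurableSpace α]
    {f : α → Matrix (Fin d) (Fin d) ℝ} {g : α → Matrix (Fin d) (Fin n) ℝ}
    (hf : ∀ i j, Measurable fun x => f x i j) (hg : ∀ i j, Measurable fun x => g x i j)
    (i : Fin d) (j : Fin n) : Measurable fun x => layer (f x) (g x) i j := by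
  have h : ∀ j, Measurable fun x => (f x * g x) i j := fun j => by
    simp only [mul_apply]
    exact Finset.measurable_sum _ fun k _ => (hf i k).mul (hg k j)
  simp only [layer, Matrix.smul_apply, smul_eq_mul, batchNorm_apply, dotProduct]
  exact (((Finset.measurable_sum _ fun k _ => (h k).mul (h k)).pow_const _).mul (h j)).const_mul _

/-! ### Fluctuation and drift of one layer with deterministic input. -/

section FixedInput

variable {Ω : Type*} [MeasurableSpace Ω] {μ : Measure Ω} [IsProbabilityMeasure μ]
  {A : Ω → Matrix (Fin d) (Fin d) ℝ}

/-- Pairwise independence of the rows makes each entry's variance additive. Bounding variances by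
second moments and summing over entries first, each row contributes at most 1, for a total of d/d².
-/
lemma integral_sumSq_gram_sub_le (hd : 1 ≤ d)
    (hA : ∀ i, Measurable fun ω => A ω i)
    (hlaw : ∀ i, μ.map (fun ω => A ω i) = gaussianVec d v)
    (hindep : Pairwise fun i j => IndepFun (fun ω => A ω i) (fun ω => A ω j) μ)
    (H : Matrix (Fin d) (Fin n) ℝ) :
    Integrable (fun ω => sumSq ((layer (A ω) H)ᵀ * layer (A ω) H - meanGram v H)) μ ∧
    ∫ ω, sumSq ((layer (A ω) H)ᵀ * layer (A ω) H - meanGram v H) ∂μ ≤ 1 / d := by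
  have hd' : (0 : ℝ) < d := by exact_mod_cast hd
  have hL : ∀ a b i, MemLp (fun ω => rowGram H a b (A ω i)) 2 μ := fun a b i =>
    memLp_rowGram_comp H a b (hA i) 2
  set S : Fin n → Fin n → Ω → ℝ := fun a b => ∑ i, fun ω => rowGram H a b (A ω i) with hSdef
  have hS : ∀ a b, MemLp (S a b) 2 μ := fun a b => memLp_finsetSum' _ fun i _ => hL a b i
  have hmean : ∀ a b, ∫ ω, S a b ω ∂μ = d * meanGram v H a b := fun a b => by
    simp only [hSdef, Finset.sum_apply]
    rw [integral_finsetSum _ fun i _ => (hL a b i).integrable (by norm_num)]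
    have : ∀ i, ∫ ω, rowGram H a b (A ω i) ∂μ = meanGram v H a b := fun i => by
      rw [← integral_map (φ := fun ω => A ω i) (hA i).aemeasurable
        (measurable_rowGram H a b).aestronglyMeasurable, hlaw i]
      rfl
    simp [this]
  have hentry : ∀ ω a b, ((layer (A ω) H)ᵀ * layer (A ω) H - meanGram v H) a b ^ 2 =
      (S a b ω - ∫ ω, S a b ω ∂μ) ^ 2 / d ^ 2 := fun ω a b => by
    rw [Matrix.sub_apply, gram_layer_apply, hmean, ← div_pow]
    simp only [hSdef, Finset.sum_apply]
    field_simp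
  have hi : ∀ a b, Integrable (fun ω => (S a b ω - ∫ ω, S a b ω ∂μ) ^ 2) μ := fun a b =>
    ((hS a b).sub (memLp_const _)).integrable_sq
  have hvar : ∀ a b, ∫ ω, (S a b ω - ∫ ω, S a b ω ∂μ) ^ 2 ∂μ ≤
      ∑ i, ∫ ω, rowGram H a b (A ω i) ^ 2 ∂μ := fun a b => by
    rw [← variance_eq_integral (hS a b).aemeasurable]
    rw [hSdef, IndepFun.variance_sum (fun i _ => hL a b i) fun i _ j _ hij =>
      (hindep hij).comp (measurable_rowGram H a b) (measurable_rowGram H a b)]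
    exact Finset.sum_le_sum fun i _ => variance_le_expectation_sq (hL a b i).aestronglyMeasurable
  simp only [sumSq, hentry]
  have hi' : ∀ a b, Integrable (fun ω => (S a b ω - ∫ ω, S a b ω ∂μ) ^ 2 / (d : ℝ) ^ 2) μ :=
    fun a b => (hi a b).div_const _
  refine ⟨integrable_finsetSum _ fun a _ => integrable_finsetSum _ fun b _ => hi' a b, ?_⟩
  rw [integral_finsetSum _ fun a _ => integrable_finsetSum _ fun b _ => hi' a b]
  simp_rw [integral_finsetSum _ fun b _ => hi' _ b, integral_div]
  calc ∑ a, ∑ b, (∫ ω, (S a b ω - ∫ ω, S a b ω ∂μ) ^ 2 ∂μ) / (d : ℝ) ^ 2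
      ≤ ∑ a, ∑ b, (∑ i, ∫ ω, rowGram H a b (A ω i) ^ 2 ∂μ) / (d : ℝ) ^ 2 :=
        Finset.sum_le_sum fun a _ => Finset.sum_le_sum fun b _ =>
          div_le_div_of_nonneg_right (hvar a b) (by positivity)
    _ = (∑ i, ∫ ω, ∑ a, ∑ b, rowGram H a b (A ω i) ^ 2 ∂μ) / (d : ℝ) ^ 2 := by
        simp_rw [← Finset.sum_div]
        congr 1
        have : ∀ i, ∫ ω, ∑ a, ∑ b, rowGram H a b (A ω i) ^ 2 ∂μ =
            ∑ a, ∑ b, ∫ ω, rowGram H a b (A ω i) ^ 2 ∂μ := fun i => by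
          rw [integral_finsetSum _ fun a _ => integrable_finsetSum _ fun b _ =>
            (hL a b i).integrable_sq]
          simp_rw [integral_finsetSum _ fun b _ => (hL _ b i).integrable_sq]
        simp_rw [this]
        exact (Finset.sum_congr rfl fun a _ => Finset.sum_comm).trans Finset.sum_comm
    _ ≤ (∑ _i : Fin d, (1 : ℝ)) / (d : ℝ) ^ 2 := by
        refine div_le_div_of_nonneg_right (Finset.sum_le_sum fun i _ => ?_) (by positivity)
        calc _ ≤ ∫ _ω, (1 : ℝ) ∂μ := integral_mono
              (integrable_finsetSum _ fun a _ => integrable_finsetSum _ fun b _ =>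
                (hL a b i).integrable_sq) (integrable_const _)
              fun ω => sum_sq_rowGram_le_one H (A ω i)
          _ = 1 := by simp
    _ = 1 / d := by
        simp
        field_simp

/-- One-step drift of `σ_n²` for a deterministic input. -/
lemma drift_sub_le_integral_sigmaMin_sq (hd : 1 ≤ d) (hn : 1 ≤ n) (hv : v ≠ 0)
    (hA : ∀ i, Measurable fun ω => A ω i)
    (hlaw : ∀ i, μ.map (fun ω => A ω i) = gaussianVec d v)
    (hindep : Pairwise fun i j => IndepFun (fun ω => A ω i) (fun ω => A ω j) μ)
    {H : Matrix (Fin d) (Fin n) ℝ} (hH : sumSq H ≤ 1) :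
    sigmaMin H ^ 2 + 2 / 3 * (sigmaMin H ^ 2 * (1 / n - sigmaMin H ^ 2)) - 1 / √(d : ℝ) ≤
      ∫ ω, sigmaMin (layer (A ω) H) ^ 2 ∂μ := by
  have hd' : (0 : ℝ) < d := by exact_mod_cast hd
  set s := sigmaMin H ^ 2 with hs
  set h := (n + 2) / n * (s / (1 + 2 * s)) with hh
  have hs0 : 0 ≤ s := sq_nonneg _
  obtain ⟨hi, hle⟩ := integral_sumSq_gram_sub_le hd hA hlaw hindep H
  set F := fun ω => sumSq ((layer (A ω) H)ᵀ * layer (A ω) H - meanGram v H) with hF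
  have hdrift : s + 2 / 3 * (s * (1 / n - s)) ≤ h := drift_le hn hs0 (sigmaMin_sq_le_inv hn hH)
  -- The arithmetic-geometric mean inequality √F ≤ (√d F + 1/√d)/2 makes the error linear in F.
  -- Since the mean of F is at most 1/d, integration leaves at most 1/√d.
  have hpt : ∀ ω, h - (√(d : ℝ) * F ω + 1 / √(d : ℝ)) / 2 ≤ sigmaMin (layer (A ω) H) ^ 2 :=
    fun ω => by
      refine le_trans ?_ (sub_sqrt_sumSq_le_sigmaMin_sq hn (layer (A ω) H) (meanGram v H) (c := h)
        fun x hx => ?_)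
      · refine sub_le_sub_left ?_ _
        have h1 : F ω = √(F ω) * √(F ω) := (Real.mul_self_sqrt (sumSq_nonneg _)).symm
        have h2 : 0 < √(d : ℝ) := Real.sqrt_pos.2 hd'
        change √(F ω) ≤ _
        rw [le_div_iff₀ two_pos, ← sub_nonneg]
        have h3 : √(d : ℝ) * F ω + 1 / √(d : ℝ) - √(F ω) * 2 =
            (√(d : ℝ) * √(F ω) - 1) ^ 2 / √(d : ℝ) := by
          rw [eq_div_iff h2.ne', sub_mul, add_mul, one_div, inv_mul_cancel₀ h2.ne', sub_sq,
            mul_pow]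
          nth_rewrite 1 [h1]
          ring
        rw [h3]
        positivity
      · rw [dotProduct_meanGram_mulVec]
        refine le_integral_normalized_quadratic hn hv hs0 (fun x => ?_) hH hx
        rw [← mulVec_dotProduct_mulVec]
        exact sigmaMin_sq_mul_le hn H x
  have hmeas : Measurable fun ω => sigmaMin (layer (A ω) H) ^ 2 :=
    measurable_sigmaMin_sq_comp hn (measurable_layer_apply
      (fun i j => (measurable_pi_apply j).comp (hA i)) fun _ _ => measurable_const)
  have hint : Integrable (fun ω => sigmaMin (layer (A ω) H) ^ 2) μ :=
    Integrable.of_bound (C := 1 / n) hmeas.aestronglyMeasurable (ae_of_all _ fun ω => by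
      rw [Real.norm_of_nonneg (sq_nonneg _)]
      exact sigmaMin_sq_le_inv hn (sumSq_layer_le_one _ _))
  have hlow : Integrable (fun ω => (√(d : ℝ) * F ω + 1 / √(d : ℝ)) / 2) μ :=
    ((hi.const_mul _).add (integrable_const _)).div_const _
  refine le_trans ?_ (integral_mono ((integrable_const h).sub hlow) hint hpt)
  rw [integral_sub' (integrable_const h) hlow, integral_div,
    integral_add (hi.const_mul _) (integrable_const _), integral_const_mul √(d : ℝ)]
  have h4 : √(d : ℝ) * ∫ ω, F ω ∂μ ≤ 1 / √(d : ℝ) := by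
    refine (mul_le_mul_of_nonneg_left hle (Real.sqrt_nonneg _)).trans (le_of_eq ?_)
    rw [mul_one_div, Real.sqrt_div_self']
  simp only [integral_const, probReal_univ, smul_eq_mul, one_mul]
  linarith

end FixedInput

end

/-! ### Independence and drift along the chain. -/

section

variable {d n : ℕ}

lemma hidden_congr {W W' : ℕ → Matrix (Fin d) (Fin d) ℝ} (H : Matrix (Fin d) (Fin n) ℝ) :
    ∀ {k : ℕ}, (∀ m < k, W m = W' m) → hidden W H k = hidden W' H k
  | 0, _ => rfl
  | k + 1, h => by
    rw [hidden, hidden, h k k.lt_succ_self, hidden_congr H fun m hm => h m (hm.trans k.lt_succ_self)]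

lemma measurable_hidden_apply {α : Type*} [MeasurableSpace α]
    {W : α → ℕ → Matrix (Fin d) (Fin d) ℝ} {H : α → Matrix (Fin d) (Fin n) ℝ}
    (hW : ∀ k i j, Measurable fun x => W x k i j) (hH : ∀ i j, Measurable fun x => H x i j)
    (k : ℕ) : ∀ i j, Measurable fun x => hidden (W x) (H x) k i j := by
  induction k with
  | zero => exact hH
  | succ k ih => exact measurable_layer_apply (hW k) ih

lemma sumSq_hidden_le_one {W : ℕ → Matrix (Fin d) (Fin d) ℝ} {H : Matrix (Fin d) (Fin n) ℝ}
    (hH : sumSq H ≤ 1) : ∀ k, sumSq (hidden W H k) ≤ 1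
  | 0 => hH
  | _ + 1 => sumSq_layer_le_one _ _

section Independence

variable {Ω : Type*} [MeasurableSpace Ω] {μ : Measure Ω} [IsProbabilityMeasure μ]

/-- If `X` is independent of `(Y, Z)` and `Y` of `Z`, then `(X, Y)` is independent of `Z`. -/
lemma indepFun_prodMk_left_of_indepFun_prodMk_right {α β γ : Type*} [MeasurableSpace α]
    [MeasurableSpace β] [MeasurableSpace γ] {X : Ω → α} {Y : Ω → β} {Z : Ω → γ}
    (hX : Measurable X) (hY : Measurable Y) (hZ : Measurable Z)
    (h : IndepFun X (fun ω => (Y ω, Z ω)) μ) (hYZ : IndepFun Y Z μ) :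
    IndepFun (fun ω => (X ω, Y ω)) Z μ := by
  have := Measure.isProbabilityMeasure_map (μ := μ) hX.aemeasurable
  have := Measure.isProbabilityMeasure_map (μ := μ) hY.aemeasurable
  have := Measure.isProbabilityMeasure_map (μ := μ) hZ.aemeasurable
  have hXY : IndepFun X Y μ := h.comp measurable_id measurable_fst
  rw [indepFun_iff_map_prod_eq_prod_map_map (hX.prodMk hY).aemeasurable hZ.aemeasurable,
    hXY.map_prod_eq_prod_map_map hX.aemeasurable hY.aemeasurable]
  have h1 := h.map_prod_eq_prod_map_map hX.aemeasurable (hY.prodMk hZ).aemeasurable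
  rw [hYZ.map_prod_eq_prod_map_map hY.aemeasurable hZ.aemeasurable,
    ← Measure.prodAssoc_prod] at h1
  apply MeasurableEquiv.prodAssoc.map_measurableEquiv_injective
  rw [← h1, Measure.map_map MeasurableEquiv.prodAssoc.measurable ((hX.prodMk hY).prodMk hZ)]
  rfl

/-- Fubini on the product law: a bound valid for frozen X, with Y averaged, integrates to a bound
for the independent pair. It transfers the fixed-input drift to the random H_k. -/
lemma integral_le_integral_of_indepFun {α β : Type*} [MeasurableSpace α] [MeasurableSpace β]
    {X : Ω → α} {Y : Ω → β} (hX : Measurable X) (hY : Measurable Y) (h : IndepFun X Y μ)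
    {f : α × β → ℝ} (hf : Measurable f) {C : ℝ} (hC : ∀ p, |f p| ≤ C) {g : Ω → ℝ}
    (hg : Integrable g μ) (hgf : ∀ᵐ ω ∂μ, g ω ≤ ∫ ω', f (X ω, Y ω') ∂μ) :
    ∫ ω, g ω ∂μ ≤ ∫ ω, f (X ω, Y ω) ∂μ := by
  have := Measure.isProbabilityMeasure_map (μ := μ) hX.aemeasurable
  have := Measure.isProbabilityMeasure_map (μ := μ) hY.aemeasurable
  have hint : Integrable f ((μ.map X).prod (μ.map Y)) :=
    Integrable.of_bound hf.aestronglyMeasurable C (ae_of_all _ hC)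
  have hfx : ∀ x, ∫ y, f (x, y) ∂(μ.map Y) = ∫ ω', f (x, Y ω') ∂μ := fun x =>
    integral_map hY.aemeasurable (hf.comp measurable_prodMk_left).aestronglyMeasurable
  have hint' := hint.integral_prod_left
  rw [← integral_map (φ := fun ω => (X ω, Y ω)) (hX.prodMk hY).aemeasurable
    hf.aestronglyMeasurable, h.map_prod_eq_prod_map_map hX.aemeasurable hY.aemeasurable,
    integral_prod _ hint, integral_map hX.aemeasurable hint'.aestronglyMeasurable]
  refine integral_mono_ae hg (hint'.comp_measurable hX) ?_
  filter_upwards [hgf] with ω hω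
  simpa only [hfx] using hω

end Independence

section Chain

variable {Ω : Type*} [MeasurableSpace Ω] {μ : Measure Ω}
  {H₀ : Ω → Matrix (Fin d) (Fin n) ℝ} {W : ℕ → Ω → Matrix (Fin d) (Fin d) ℝ}

lemma map_row_eq_gaussianVec {v : NNReal} (hW_meas : ∀ k i j, Measurable fun ω => W k ω i j)
    (hW_law : ∀ k i j, μ.map (fun ω => W k ω i j) = gaussianReal 0 v)
    (hW_indep : iIndepFun (fun (p : ℕ × Fin d × Fin d) ω => W p.1 ω p.2.1 p.2.2) μ)
    (k : ℕ) (i : Fin d) : μ.map (fun ω => W k ω i) = gaussianVec d v := by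
  have hinj : Function.Injective fun j : Fin d => (k, i, j) := fun a b h => by simpa using h
  have h := (hW_indep.precomp hinj).map_fun_eq_pi_map fun j => (hW_meas k i j).aemeasurable
  simp only [hW_law] at h
  exact h

lemma indepFun_row (hW_meas : ∀ k i j, Measurable fun ω => W k ω i j)
    (hW_indep : iIndepFun (fun (p : ℕ × Fin d × Fin d) ω => W p.1 ω p.2.1 p.2.2) μ)
    (k : ℕ) {i i' : Fin d} (hi : i ≠ i') :
    IndepFun (fun ω => W k ω i) (fun ω => W k ω i') μ := by
  have h := hW_indep.indepFun_finset ({k} ×ˢ {i} ×ˢ Finset.univ) ({k} ×ˢ {i'} ×ˢ Finset.univ)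
    (by
      rw [Finset.disjoint_left]
      rintro ⟨a, b, c⟩ h1 h2
      simp only [Finset.mem_product, Finset.mem_singleton, Finset.mem_univ, and_true] at h1 h2
      exact hi (h1.2.symm.trans h2.2)) fun p => hW_meas _ _ _
  have hrestr : ∀ b : Fin d, Measurable
      fun (w : ({k} ×ˢ {b} ×ˢ Finset.univ : Finset (ℕ × Fin d × Fin d)) → ℝ) (j : Fin d) =>
        w ⟨(k, b, j), by simp⟩ := fun b => by fun_prop
  exact h.comp (hrestr i) (hrestr i')

variable [IsProbabilityMeasure μ]

lemma indepFun_hidden_weight (hH₀_meas : ∀ i j, Measurable fun ω => H₀ ω i j)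
    (hW_meas : ∀ k i j, Measurable fun ω => W k ω i j)
    (hW_indep : iIndepFun (fun (p : ℕ × Fin d × Fin d) ω => W p.1 ω p.2.1 p.2.2) μ)
    (hH₀_indep : IndepFun (fun ω (q : Fin d × Fin n) => H₀ ω q.1 q.2)
      (fun ω (p : ℕ × Fin d × Fin d) => W p.1 ω p.2.1 p.2.2) μ) (k : ℕ) :
    IndepFun (fun ω (i : Fin d) (j : Fin n) => hidden (fun k => W k ω) (H₀ ω) k i j)
      (fun ω (i j : Fin d) => W k ω i j) μ := by
  set S : Finset (ℕ × Fin d × Fin d) := Finset.range k ×ˢ Finset.univ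
  set T : Finset (ℕ × Fin d × Fin d) := {k} ×ˢ Finset.univ
  have hST : Disjoint S T := by
    rw [Finset.disjoint_left]
    rintro ⟨a, b⟩ h1 h2
    simp only [S, T, Finset.mem_product, Finset.mem_singleton, Finset.mem_univ, and_true,
      Finset.mem_range] at h1 h2
    omega
  have hWST := hW_indep.indepFun_finset S T hST fun p => hW_meas _ _ _
  have hWmeas : ∀ R : Finset (ℕ × Fin d × Fin d),
      Measurable fun ω (p : R) => W p.1.1 ω p.1.2.1 p.1.2.2 := fun R =>
    measurable_pi_lambda _ fun p => hW_meas _ _ _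
  have hH0 : Measurable fun ω (q : Fin d × Fin n) => H₀ ω q.1 q.2 :=
    measurable_pi_lambda _ fun q => hH₀_meas _ _
  have hrestr : Measurable fun w : ℕ × Fin d × Fin d → ℝ =>
      ((fun p : S => w p.1), fun p : T => w p.1) := by fun_prop
  -- S indexes the weights before layer k and T those of layer k; the input joins the past weights,
  -- and the pair is independent of the present ones.
  have h := indepFun_prodMk_left_of_indepFun_prodMk_right hH0 (hWmeas S) (hWmeas T)
    (hH₀_indep.comp measurable_id hrestr) hWST
  -- Weights outside S are filled with 0, which is harmless since H_k depends only on the weights of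
  -- layers m < k (`hidden_congr`).
  let ext : (S → ℝ) → ℕ → Matrix (Fin d) (Fin d) ℝ := fun w m =>
    Matrix.of fun i j => if hm : (m, i, j) ∈ S then w ⟨(m, i, j), hm⟩ else 0
  have hext : ∀ m i j, Measurable fun x : (Fin d × Fin n → ℝ) × (S → ℝ) => ext x.2 m i j :=
    fun m i j => by
      simp only [ext, of_apply]
      split_ifs <;> fun_prop
  have hfst : Measurable fun (x : (Fin d × Fin n → ℝ) × (S → ℝ)) (i : Fin d) (j : Fin n) =>
      hidden (ext x.2) (Matrix.of fun i j => x.1 (i, j)) k i j :=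
    measurable_pi_lambda _ fun i => measurable_pi_lambda _ fun j =>
      measurable_hidden_apply hext (fun i j => by simp only [of_apply]; fun_prop) k i j
  have hsnd : Measurable fun (w : T → ℝ) (i j : Fin d) => w ⟨(k, i, j), by simp [T]⟩ := by
    fun_prop
  convert! h.comp hfst hsnd using 1
  funext ω i j
  simp only [Function.comp_apply]
  refine congrFun (congrFun (hidden_congr (H₀ ω) fun m hm => ?_) i) j
  ext i j
  simp [ext, S, hm]

variable {v : NNReal}

lemma measurable_sigmaMin_sq_hidden (hn : 1 ≤ n) (hH₀_meas : ∀ i j, Measurable fun ω => H₀ ω i j)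
    (hW_meas : ∀ k i j, Measurable fun ω => W k ω i j) (k : ℕ) :
    Measurable fun ω => sigmaMin (hidden (fun k => W k ω) (H₀ ω) k) ^ 2 :=
  measurable_sigmaMin_sq_comp hn
    (measurable_hidden_apply (fun k i j => hW_meas k i j) hH₀_meas k)

lemma integrable_sigmaMin_sq_hidden (hn : 1 ≤ n) (hH₀_meas : ∀ i j, Measurable fun ω => H₀ ω i j)
    (hH₀_norm : ∀ᵐ ω ∂μ, sumSq (H₀ ω) ≤ 1)
    (hW_meas : ∀ k i j, Measurable fun ω => W k ω i j) (k : ℕ) :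
    Integrable (fun ω => sigmaMin (hidden (fun k => W k ω) (H₀ ω) k) ^ 2) μ := by
  refine Integrable.of_bound (C := 1 / n)
    (measurable_sigmaMin_sq_hidden hn hH₀_meas hW_meas k).aestronglyMeasurable ?_
  filter_upwards [hH₀_norm] with ω hω
  rw [Real.norm_of_nonneg (sq_nonneg _)]
  exact sigmaMin_sq_le_inv hn (sumSq_hidden_le_one hω k)

lemma integrable_sigmaMin_sq_mul_hidden (hn : 1 ≤ n)
    (hH₀_meas : ∀ i j, Measurable fun ω => H₀ ω i j) (hH₀_norm : ∀ᵐ ω ∂μ, sumSq (H₀ ω) ≤ 1)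
    (hW_meas : ∀ k i j, Measurable fun ω => W k ω i j) (k : ℕ) :
    Integrable (fun ω => sigmaMin (hidden (fun k => W k ω) (H₀ ω) k) ^ 2 *
      (1 / n - sigmaMin (hidden (fun k => W k ω) (H₀ ω) k) ^ 2)) μ := by
  have hm := measurable_sigmaMin_sq_hidden hn hH₀_meas hW_meas k
  refine (integrable_sigmaMin_sq_hidden hn hH₀_meas hH₀_norm hW_meas k).mul_bdd (c := 1 / n)
    (hm.const_sub _).aestronglyMeasurable ?_
  filter_upwards [hH₀_norm] with ω hω
  have h1 := sigmaMin_sq_le_inv hn (sumSq_hidden_le_one (W := fun k => W k ω) hω k)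
  rw [Real.norm_of_nonneg (by linarith)]
  linarith [sq_nonneg (sigmaMin (hidden (fun k => W k ω) (H₀ ω) k))]

/-- Expected one-step drift of `σ_n²` along the chain. -/
lemma integral_sigmaMin_sq_hidden_succ (hd : 1 ≤ d) (hn : 1 ≤ n) (hv : v ≠ 0)
    (hH₀_meas : ∀ i j, Measurable fun ω => H₀ ω i j) (hH₀_norm : ∀ᵐ ω ∂μ, sumSq (H₀ ω) ≤ 1)
    (hW_meas : ∀ k i j, Measurable fun ω => W k ω i j)
    (hW_law : ∀ k i j, μ.map (fun ω => W k ω i j) = gaussianReal 0 v)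
    (hW_indep : iIndepFun (fun (p : ℕ × Fin d × Fin d) ω => W p.1 ω p.2.1 p.2.2) μ)
    (hH₀_indep : IndepFun (fun ω (q : Fin d × Fin n) => H₀ ω q.1 q.2)
      (fun ω (p : ℕ × Fin d × Fin d) => W p.1 ω p.2.1 p.2.2) μ) (k : ℕ) :
    ∫ ω, sigmaMin (hidden (fun k => W k ω) (H₀ ω) k) ^ 2 ∂μ +
      2 / 3 * ∫ ω, sigmaMin (hidden (fun k => W k ω) (H₀ ω) k) ^ 2 *
        (1 / n - sigmaMin (hidden (fun k => W k ω) (H₀ ω) k) ^ 2) ∂μ - 1 / √(d : ℝ) ≤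
      ∫ ω, sigmaMin (hidden (fun k => W k ω) (H₀ ω) (k + 1)) ^ 2 ∂μ := by
  have hi := integrable_sigmaMin_sq_hidden hn hH₀_meas hH₀_norm hW_meas k
  have hi' := integrable_sigmaMin_sq_mul_hidden hn hH₀_meas hH₀_norm hW_meas k
  have hX : Measurable fun ω (i : Fin d) (j : Fin n) => hidden (fun k => W k ω) (H₀ ω) k i j :=
    measurable_pi_lambda _ fun i => measurable_pi_lambda _ fun j =>
      measurable_hidden_apply (fun k i j => hW_meas k i j) hH₀_meas k i j
  have hrow : ∀ i, Measurable fun ω => W k ω i := fun i =>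
    measurable_pi_lambda _ fun j => hW_meas k i j
  have hY : Measurable fun ω (i j : Fin d) => W k ω i j := measurable_pi_lambda _ hrow
  have hf : Measurable fun p : (Fin d → Fin n → ℝ) × (Fin d → Fin d → ℝ) =>
      sigmaMin (layer (Matrix.of p.2) (Matrix.of p.1)) ^ 2 :=
    measurable_sigmaMin_sq_comp hn (measurable_layer_apply
      (fun i j => by simp only [of_apply]; fun_prop) (fun i j => by simp only [of_apply]; fun_prop))
  have hsum := hi.add (hi'.const_mul (2 / 3))
  have key := integral_le_integral_of_indepFun hX hY
    (indepFun_hidden_weight hH₀_meas hW_meas hW_indep hH₀_indep k) hf (C := 1 / n)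
    (fun p => by
      rw [abs_of_nonneg (sq_nonneg _)]
      exact sigmaMin_sq_le_inv hn (sumSq_layer_le_one _ _))
    -- The pointwise drift uses H_k(ω) as a frozen input and averages over the weights alone.
    (hsum.sub (integrable_const (1 / √(d : ℝ)))) (by
      filter_upwards [hH₀_norm] with ω hω
      exact drift_sub_le_integral_sigmaMin_sq hd hn hv hrow
        (map_row_eq_gaussianVec hW_meas hW_law hW_indep k)
        (fun i i' hii => indepFun_row hW_meas hW_indep k hii) (sumSq_hidden_le_one hω k))
  refine le_trans (le_of_eq ?_) key
  rw [integral_sub' hsum (integrable_const _), integral_add' hi (hi'.const_mul _),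
    integral_const_mul]
  simp

end Chain

/-- Summation of a drift inequality `a k + (2/3) b k - e ≤ a (k+1)`. -/
lemma sum_Icc_le_of_drift {a b : ℕ → ℝ} {e : ℝ} (h : ∀ k, a k + 2 / 3 * b k - e ≤ a (k + 1))
    (ℓ : ℕ) : ∑ k ∈ Finset.Icc 1 ℓ, b k ≤ 3 / 2 * (a ℓ - a 0 + ℓ * e) + b ℓ - b 0 := by
  -- Telescoping the drift controls b 0, ..., b (ℓ-1), whereas the sum runs over 1, ..., ℓ; hence
  -- the boundary terms b ℓ - b 0.
  induction ℓ with
  | zero => simp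
  | succ ℓ ih =>
    rw [Finset.sum_Icc_succ_top (by omega)]
    push_cast
    linarith [h ℓ]

end

end BNChain

end

/-! ### Assembly of the bound. -/

theorem mainTheorem5 {Ω : Type*} [MeasurableSpace Ω] (μ : Measure Ω) [IsProbabilityMeasure μ]
    (d n : ℕ) (hn : 1 ≤ n) (hnd : n ≤ d)
    (H₀ : Ω → Matrix (Fin d) (Fin n) ℝ) (W : ℕ → Ω → Matrix (Fin d) (Fin d) ℝ)
    -- the input: a random matrix of unit Frobenius norm
    (hH₀_meas : ∀ i j, Measurable fun ω => H₀ ω i j)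
    (hH₀_norm : ∀ᵐ ω ∂μ, BNChain.frobeniusNorm (H₀ ω) = 1)
    -- the weights: all entries of all layers are i.i.d. centred Gaussian of variance `1/d`
    (hW_meas : ∀ k i j, Measurable fun ω => W k ω i j)
    (hW_law : ∀ k i j, μ.map (fun ω => W k ω i j) = gaussianReal 0 (1 / (d : NNReal)))
    (hW_indep : iIndepFun (fun (p : ℕ × Fin d × Fin d) ω => W p.1 ω p.2.1 p.2.2) μ)
    -- the input is independent of the whole family of weights
    (hH₀_indep : IndepFun (fun ω (q : Fin d × Fin n) => H₀ ω q.1 q.2)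
      (fun ω (p : ℕ × Fin d × Fin d) => W p.1 ω p.2.1 p.2.2) μ)
    (ℓ : ℕ) (hℓ : 1 ≤ ℓ) :
    Integrable (fun ω => BNChain.VHat (H₀ ω)) μ ∧
    Integrable (fun ω => BNChain.depthAverage (fun k => W k ω) (H₀ ω) ℓ) μ ∧
    ∫ ω, BNChain.depthAverage (fun k => W k ω) (H₀ ω) ℓ ∂μ
      ≤ 3 * (∫ ω, BNChain.VHat (H₀ ω) ∂μ) / (2 * (ℓ : ℝ)) + 3 / (2 * √(d : ℝ)) := by
  have hd : 1 ≤ d := hn.trans hnd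
  have hv : (1 / (d : NNReal)) ≠ 0 := by
    have : (d : NNReal) ≠ 0 := Nat.cast_ne_zero.2 (by omega)
    positivity
  have hnorm : ∀ᵐ ω ∂μ, BNChain.sumSq (H₀ ω) ≤ 1 := by
    filter_upwards [hH₀_norm] with ω hω
    rw [BNChain.sumSq_eq_frobeniusNorm_sq, hω, one_pow]
  have hℓ' : (0 : ℝ) < ℓ := by exact_mod_cast hℓ
  have hi := BNChain.integrable_sigmaMin_sq_hidden hn hH₀_meas hnorm hW_meas
  have hi' := BNChain.integrable_sigmaMin_sq_mul_hidden hn hH₀_meas hnorm hW_meas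
  set s : ℕ → Ω → ℝ := fun k ω => BNChain.sigmaMin (BNChain.hidden (fun k => W k ω) (H₀ ω) k) ^ 2
  have hV0 : Integrable (fun ω => BNChain.VHat (H₀ ω)) μ := (integrable_const _).sub (hi 0)
  -- The product V̂(1/n - V̂) is unchanged when V̂ = 1/n - s is exchanged with s.
  have hdepth : (fun ω => BNChain.depthAverage (fun k => W k ω) (H₀ ω) ℓ) =
      fun ω => 1 / (ℓ : ℝ) * ∑ k ∈ Finset.Icc 1 ℓ, s k ω * (1 / n - s k ω) := by
    funext ω
    unfold BNChain.depthAverage BNChain.VHat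
    congr 1
    exact Finset.sum_congr rfl fun k _ => by ring
  have hsum : Integrable (fun ω => ∑ k ∈ Finset.Icc 1 ℓ, s k ω * (1 / n - s k ω)) μ :=
    integrable_finsetSum _ fun k _ => hi' k
  refine ⟨hV0, by rw [hdepth]; exact hsum.const_mul _, ?_⟩
  have hV0_int : ∫ ω, BNChain.VHat (H₀ ω) ∂μ = 1 / n - ∫ ω, s 0 ω ∂μ := by
    refine (integral_sub (integrable_const (1 / (n : ℝ))) (hi 0)).trans ?_
    simp only [integral_const, probReal_univ, smul_eq_mul, one_mul, s]
  have hbound := BNChain.sum_Icc_le_of_drift (BNChain.integral_sigmaMin_sq_hidden_succ hd hn hv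
    hH₀_meas hnorm hW_meas hW_law hW_indep hH₀_indep) ℓ
  have hs_le : ∀ k, ∀ᵐ ω ∂μ, s k ω ≤ 1 / n := fun k => by
    filter_upwards [hnorm] with ω hω
    exact BNChain.sigmaMin_sq_le_inv hn (BNChain.sumSq_hidden_le_one hω k)
  have hb0 : 0 ≤ ∫ ω, s 0 ω * (1 / n - s 0 ω) ∂μ := by
    refine integral_nonneg_of_ae ?_
    filter_upwards [hs_le 0] with ω hω
    exact mul_nonneg (sq_nonneg _) (sub_nonneg.2 hω)
  -- The boundary term at depth ℓ is absorbed: s ≤ 1 ≤ 3/2 gives s(1/n - s) ≤ (3/2)(1/n - s), which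
  -- cancels the terminal value in the telescoped bound and leaves 3/2 times the initial mean of V̂.
  have hbℓ : ∫ ω, s ℓ ω * (1 / n - s ℓ ω) ∂μ ≤ 3 / 2 * (1 / n - ∫ ω, s ℓ ω ∂μ) := by
    have h1 : 3 / 2 * (1 / n - ∫ ω, s ℓ ω ∂μ) = ∫ ω, 3 / 2 * (1 / n - s ℓ ω) ∂μ := by
      rw [integral_const_mul, integral_sub (integrable_const _) (hi ℓ)]
      simp only [integral_const, probReal_univ, smul_eq_mul, one_mul, s]
    rw [h1]
    refine integral_mono_ae (hi' ℓ) (((integrable_const _).sub (hi ℓ)).const_mul _) ?_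
    filter_upwards [hs_le ℓ] with ω hω
    have hn1 : 1 / (n : ℝ) ≤ 1 := by
      rw [div_le_one (by exact_mod_cast hn)]; exact_mod_cast hn
    exact mul_le_mul_of_nonneg_right (by linarith) (sub_nonneg.2 hω)
  rw [hdepth, integral_const_mul, integral_finsetSum _ fun k _ => hi' k, hV0_int]
  calc 1 / (ℓ : ℝ) * ∑ k ∈ Finset.Icc 1 ℓ, ∫ ω, s k ω * (1 / n - s k ω) ∂μ
      ≤ 1 / (ℓ : ℝ) * (3 / 2 * (1 / n - ∫ ω, s 0 ω ∂μ + ℓ * (1 / √(d : ℝ)))) := by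
        refine mul_le_mul_of_nonneg_left ?_ (by positivity)
        refine hbound.trans ?_
        change 3 / 2 * (∫ ω, s ℓ ω ∂μ - ∫ ω, s 0 ω ∂μ + ℓ * (1 / √(d : ℝ))) +
          ∫ ω, s ℓ ω * (1 / n - s ℓ ω) ∂μ - ∫ ω, s 0 ω * (1 / n - s 0 ω) ∂μ ≤ _
        linarith
    _ = _ := by
        field_simp
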